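/- Let $H$ be a complex Hilbert space. A bounded linear operator $T: H \to H$ is called nuclear if there are bounded sequences $(x_n^*)_{n} \subseteq H^*$ and $(y_n)_{n} \subseteq H$ with $$\sum_{n=1}^\infty \|x_n^*\|\,\|y_n\| < \infty \quad\text{and}\quad T(x) = \sum_{n=1}^\infty x_n^*(x)\, y_n \ \text{ for every } x \in H; \qquad (\ast)$$ its nuclear norm $\|T\|_N$ is the infimum of $\sum_{n=1}^\infty \|x_n^*\|\,\|y_n\|$ over all bounded sequences $(x_n^*)_n$, $(y_n)_n$ satisfying $(\ast)$. Then every nuclear operator $T: H \to H$ attains its nuclear norm: there are bounded sequences $(x_n^*)_n \subseteq H^*$ and $(y_n)_n \subseteq H$ satisfying $(\ast)$ with $$\|T\|_N = \sum_{n=1}^\infty \|x_n^*\|\,\|y_n\|.$$ -/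

import Mathlib

section Nuclear

variable {𝕜 X Y : Type*} [RCLike 𝕜]
  [NormedAddCommGroup X] [NormedSpace 𝕜 X] [NormedAddCommGroup Y] [NormedSpace 𝕜 Y]

/-- `T = ∑ φ n ⊗ y n` is a nuclear representation of the bounded operator `T : X → Y`:
the functionals `φ n ∈ X*` and the vectors `y n ∈ Y` form bounded sequences,
`∑ ‖φ n‖ ‖y n‖ < ∞`, and `T x = ∑ φ n (x) y n` for every `x`. -/
structure IsNuclearRepresentation (T : X →L[𝕜] Y) (φ : ℕ → StrongDual 𝕜 X) (y : ℕ → Y) :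
    Prop where
  bounded_left : ∃ C : ℝ, ∀ n, ‖φ n‖ ≤ C
  bounded_right : ∃ C : ℝ, ∀ n, ‖y n‖ ≤ C
  summable : Summable fun n => ‖φ n‖ * ‖y n‖
  hasSum : ∀ x, HasSum (fun n => φ n x • y n) (T x)

/-- A bounded operator is nuclear if it has a nuclear representation. -/
def IsNuclearOperator (T : X →L[𝕜] Y) : Prop :=
  ∃ (φ : ℕ → StrongDual 𝕜 X) (y : ℕ → Y), IsNuclearRepresentation T φ y

/-- The nuclear norm of `T`: the infimum of `∑ ‖φ n‖ ‖y n‖` over all nuclear representations of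
`T` (meaningful when `T` is nuclear, so that the infimum is over a nonempty set). -/
noncomputable def nuclearNorm (T : X →L[𝕜] Y) : ℝ :=
  sInf {r : ℝ | ∃ (φ : ℕ → StrongDual 𝕜 X) (y : ℕ → Y),
    IsNuclearRepresentation T φ y ∧ r = ∑' n, ‖φ n‖ * ‖y n‖}

/-- `T` attains its nuclear norm: some nuclear representation of `T` realizes the infimum. -/
def AttainsNuclearNorm (T : X →L[𝕜] Y) : Prop :=
  ∃ (φ : ℕ → StrongDual 𝕜 X) (y : ℕ → Y),
    IsNuclearRepresentation T φ y ∧ nuclearNorm T = ∑' n, ‖φ n‖ * ‖y n‖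

end Nuclear

section RankOne

variable {𝕜 X Y : Type*} [RCLike 𝕜]
  [NormedAddCommGroup X] [NormedSpace 𝕜 X] [NormedAddCommGroup Y] [NormedSpace 𝕜 Y]

/-! A nuclear `T` is compact, so `T*T` is diagonal in a Hilbert basis `b`, which makes the vectors
`T (b i)` pairwise orthogonal. The expansion `T x = ∑ ⟪b i, x⟫ T (b i)` is then optimal. Its cost `∑
‖T (b i)‖` is the trace of `T` along `b i` and the normalized nonzero `T (b i)`, two orthonormal
families; Bessel and Cauchy–Schwarz bound such a trace by the cost of any representation
(`IsNuclearRepresentation.norm_sum_inner_le`). -/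

theorem isCompactOperator_smulRight (φ : StrongDual 𝕜 X) (y : Y) :
    IsCompactOperator (φ.smulRight y) :=
  (isCompactOperator_of_locallyCompactSpace_dom φ).clm_comp
    (ContinuousLinearMap.toSpanSingleton 𝕜 y)

/-- A nuclear operator is compact, being the norm limit of finite rank operators. -/
theorem IsNuclearOperator.isCompactOperator [CompleteSpace Y] {T : X →L[𝕜] Y}
    (hT : IsNuclearOperator T) : IsCompactOperator T := by
  obtain ⟨φ, y, h⟩ := hT
  have hs : Summable fun n => (φ n).smulRight (y n) :=
    Summable.of_norm (by simpa only [ContinuousLinearMap.norm_smulRight_apply] using h.summable)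
  have hT : ∑' n, (φ n).smulRight (y n) = T := by
    ext x
    exact ((hs.hasSum.mapL (ContinuousLinearMap.apply 𝕜 Y x)).unique (h.hasSum x))
  refine isCompactOperator_of_tendsto (hT ▸ hs.hasSum) (Filter.Eventually.of_forall fun s => ?_)
  exact Submodule.sum_mem (compactOperator (RingHom.id 𝕜) X Y)
    fun n _ => isCompactOperator_smulRight (φ n) (y n)

/-- A nuclear representation over an arbitrary countable index set, by functionals of norm at most
one, can be enumerated. -/
theorem exists_isNuclearRepresentation_of_countable {ι : Type*} [Countable ι] {T : X →L[𝕜] Y}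
    {φ : ι → StrongDual 𝕜 X} {y : ι → Y} (hφ : ∀ i, ‖φ i‖ = 1) (hy : Summable fun i => ‖y i‖)
    (hT : ∀ x, HasSum (fun i => φ i x • y i) (T x)) :
    ∃ (ψ : ℕ → StrongDual 𝕜 X) (z : ℕ → Y), IsNuclearRepresentation T ψ z ∧
      ∑' n, ‖ψ n‖ * ‖z n‖ = ∑' i, ‖y i‖ := by
  obtain ⟨g, hg⟩ := Countable.exists_injective_nat ι
  have hnorm : (fun n => ‖Function.extend g φ 0 n‖ * ‖Function.extend g y 0 n‖) =
      Function.extend g (fun i => ‖y i‖) 0 := by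
    funext n
    by_cases hn : ∃ i, g i = n
    · obtain ⟨i, rfl⟩ := hn
      simp [hg.extend_apply, hφ]
    · simp [Function.extend_apply' _ _ _ hn]
  have happly (x : X) : (fun n => Function.extend g φ 0 n x • Function.extend g y 0 n) =
      Function.extend g (fun i => φ i x • y i) 0 := by
    funext n
    by_cases hn : ∃ i, g i = n
    · obtain ⟨i, rfl⟩ := hn
      simp [hg.extend_apply]
    · simp [Function.extend_apply' _ _ _ hn]
  refine ⟨Function.extend g φ 0, Function.extend g y 0, ⟨⟨1, fun n => ?_⟩,
    ⟨∑' i, ‖y i‖, fun n => ?_⟩, ?_, fun x => ?_⟩, ?_⟩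
  · by_cases hn : ∃ i, g i = n
    · obtain ⟨i, rfl⟩ := hn
      simp [hg.extend_apply, hφ]
    · simp [Function.extend_apply' _ _ _ hn]
  · by_cases hn : ∃ i, g i = n
    · obtain ⟨i, rfl⟩ := hn
      simpa [hg.extend_apply] using hy.le_tsum i fun _ _ => norm_nonneg _
    · simpa [Function.extend_apply' _ _ _ hn] using tsum_nonneg fun i => norm_nonneg (y i)
  · rw [hnorm]
    exact ((hasSum_extend_zero hg).2 hy.hasSum).summable
  · rw [happly]
    exact (hasSum_extend_zero hg).2 (hT x)
  · rw [hnorm]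
    exact ((hasSum_extend_zero hg).2 hy.hasSum).tsum_eq

end RankOne

section Hilbert

universe u v w

variable {𝕜 : Type u} {E : Type v} {F : Type w} [RCLike 𝕜]
  [NormedAddCommGroup E] [InnerProductSpace 𝕜 E] [CompleteSpace E]
  [NormedAddCommGroup F] [InnerProductSpace 𝕜 F] [CompleteSpace F]

omit [CompleteSpace F] in
/-- The trace of an operator along a pair of orthonormal families is bounded by the cost of any of
its nuclear representations. -/
theorem IsNuclearRepresentation.norm_sum_inner_le {T : E →L[𝕜] F} {φ : ℕ → StrongDual 𝕜 E}
    {y : ℕ → F} (h : IsNuclearRepresentation T φ y) {ι : Type*} {e : ι → E} {f : ι → F}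
    (he : Orthonormal 𝕜 e) (hf : Orthonormal 𝕜 f) (s : Finset ι) :
    ‖∑ i ∈ s, inner 𝕜 (f i) (T (e i))‖ ≤ ∑' n, ‖φ n‖ * ‖y n‖ := by
  have hsum : HasSum (fun n => ∑ i ∈ s, φ n (e i) * inner 𝕜 (f i) (y n))
      (∑ i ∈ s, inner 𝕜 (f i) (T (e i))) := by
    refine hasSum_sum fun i _ => ?_
    simpa [inner_smul_right] using (h.hasSum (e i)).mapL (innerSL 𝕜 (f i))
  rw [← hsum.tsum_eq]
  refine tsum_of_norm_bounded h.summable.hasSum fun n => ?_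
  -- Bessel's inequality for the Riesz representative of `φ n`.
  have hφ : √(∑ i ∈ s, ‖φ n (e i)‖ ^ 2) ≤ ‖φ n‖ := by
    refine Real.sqrt_le_iff.2 ⟨norm_nonneg _, ?_⟩
    have := he.sum_inner_products_le ((InnerProductSpace.toDual 𝕜 E).symm (φ n)) (s := s)
    have hi (i : ι) : ‖inner 𝕜 (e i) ((InnerProductSpace.toDual 𝕜 E).symm (φ n))‖ =
        ‖φ n (e i)‖ := by
      rw [norm_inner_symm, InnerProductSpace.toDual_symm_apply]
    simpa only [hi, LinearIsometryEquiv.norm_map] using this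
  have hy : √(∑ i ∈ s, ‖inner 𝕜 (f i) (y n)‖ ^ 2) ≤ ‖y n‖ :=
    Real.sqrt_le_iff.2 ⟨norm_nonneg _, hf.sum_inner_products_le (y n)⟩
  calc ‖∑ i ∈ s, φ n (e i) * inner 𝕜 (f i) (y n)‖
      ≤ ∑ i ∈ s, ‖φ n (e i)‖ * ‖inner 𝕜 (f i) (y n)‖ := by
        simpa only [norm_mul] using norm_sum_le s fun i => φ n (e i) * inner 𝕜 (f i) (y n)
    _ ≤ √(∑ i ∈ s, ‖φ n (e i)‖ ^ 2) * √(∑ i ∈ s, ‖inner 𝕜 (f i) (y n)‖ ^ 2) :=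
        Real.sum_mul_le_sqrt_mul_sqrt s _ _
    _ ≤ ‖φ n‖ * ‖y n‖ := by gcongr

/-- A compact self-adjoint operator is diagonal in some Hilbert basis. -/
theorem exists_hilbertBasis_eigenvectors {A : E →L[𝕜] E} (hA : IsCompactOperator A)
    (hA' : (A : E →ₗ[𝕜] E).IsSymmetric) :
    ∃ (ι : Type (max u v)) (b : HilbertBasis ι 𝕜 E) (c : ι → 𝕜), ∀ i, A (b i) = c i • b i := by
  let V (μ : 𝕜) : Submodule 𝕜 E := Module.End.eigenspace (A : Module.End 𝕜 E) μ
  have hV (μ : 𝕜) : IsClosed (V μ : Set E) := by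
    have : (V μ : Set E) = {x | A x = μ • x} := by
      ext x
      exact Module.End.mem_eigenspace_iff
    rw [this]
    exact isClosed_eq A.continuous (continuous_const_smul μ)
  have (μ : 𝕜) : CompleteSpace (V μ) := (hV μ).completeSpace_coe
  choose I p hp using fun μ => exists_hilbertBasis 𝕜 (V μ)
  -- All scalars `μ` are allowed: `μ = 0` contributes the kernel, and a non-eigenvalue has an empty
  -- basis.
  have horth : Orthonormal 𝕜 fun a : Σ μ, I μ => ((p a.1 a.2 : V a.1) : E) :=
    hA'.orthogonalFamily_eigenspaces.orthonormal_sigma_orthonormal fun μ => (p μ).orthonormal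
  have hbot : (Submodule.span 𝕜 (Set.range fun a : Σ μ, I μ => ((p a.1 a.2 : V a.1) : E)))ᗮ = ⊥ := by
    rw [eq_bot_iff, ← ContinuousLinearMap.orthogonalComplement_iSup_eigenspaces_eq_bot hA hA',
      ← Submodule.iInf_orthogonal]
    refine fun x hx => (Submodule.mem_iInf _).2 fun μ v hv => ?_
    have hx' (i : I μ) : inner 𝕜 ((p μ i : V μ) : E) x = 0 :=
      hx _ (Submodule.subset_span ⟨⟨μ, i⟩, rfl⟩)
    have h := ((p μ).hasSum_repr ⟨v, hv⟩).mapL ((innerSL 𝕜 x).comp (V μ).subtypeL)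
    have h0 : inner 𝕜 x v = 0 := by
      refine h.unique ?_
      convert! hasSum_zero using 2 with i
      simp [inner_eq_zero_symm.1 (hx' i)]
    exact inner_eq_zero_symm.1 h0
  refine ⟨Σ μ, I μ, HilbertBasis.mkOfOrthogonalEqBot horth hbot, fun a => a.1, fun a => ?_⟩
  rw [HilbertBasis.coe_mkOfOrthogonalEqBot]
  exact Module.End.mem_eigenspace_iff.1 (p a.1 a.2).2

/-- **Schmidt decomposition**: a compact operator maps some Hilbert basis to an orthogonal
family. -/
theorem exists_hilbertBasis_map_orthogonal {T : E →L[𝕜] F} (hT : IsCompactOperator T) :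
    ∃ (ι : Type (max u v)) (b : HilbertBasis ι 𝕜 E),
      Pairwise fun i j => inner 𝕜 (T (b i)) (T (b j)) = 0 := by
  obtain ⟨ι, b, c, hb⟩ := exists_hilbertBasis_eigenvectors
    (A := (ContinuousLinearMap.adjoint T).comp T) (hT.clm_comp (ContinuousLinearMap.adjoint T))
    (fun x z => by simp [ContinuousLinearMap.adjoint_inner_left,
      ContinuousLinearMap.adjoint_inner_right])
  refine ⟨ι, b, fun i j hij => ?_⟩
  have hj : ContinuousLinearMap.adjoint T (T (b j)) = c j • b j := hb j
  change inner 𝕜 (T (b i)) (T (b j)) = 0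
  rw [← ContinuousLinearMap.adjoint_inner_right, hj, inner_smul_right, b.orthonormal.2 hij,
    mul_zero]

/-- A nuclear operator between Hilbert spaces attains its nuclear norm. -/
theorem IsNuclearOperator.attainsNuclearNorm {T : E →L[𝕜] F} (hT : IsNuclearOperator T) :
    AttainsNuclearNorm T := by
  obtain ⟨ι, b, hb⟩ := exists_hilbertBasis_map_orthogonal hT.isCompactOperator
  -- Dropping the kernel vectors permits normalizing `T (b i)` and leaves a countable index set even
  -- when `E` is not separable.
  let S : Set ι := {i | T (b i) ≠ 0}
  let e : S → E := fun i => b i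
  have he : Orthonormal 𝕜 e := b.orthonormal.comp _ Subtype.val_injective
  have hne (i : S) : (‖T (e i)‖ : 𝕜) ≠ 0 := by
    simpa using (show T (b i) ≠ 0 from i.2)
  let f : S → F := fun i => (‖T (e i)‖ : 𝕜)⁻¹ • T (e i)
  have hf : Orthonormal 𝕜 f := by
    refine ⟨fun i => ?_, fun i j hij => ?_⟩
    · exact norm_smul_inv_norm i.2
    · have : inner 𝕜 (T (e i)) (T (e j)) = 0 := hb fun h => hij (Subtype.ext h)
      simp [f, inner_smul_left, inner_smul_right, this]
  have hfe (i : S) : inner 𝕜 (f i) (T (e i)) = (‖T (e i)‖ : 𝕜) := by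
    simp only [f, inner_smul_left, inner_self_eq_norm_sq_to_K, map_inv₀, RCLike.conj_ofReal]
    field_simp [hne i]
  have hle {φ : ℕ → StrongDual 𝕜 E} {y : ℕ → F} (h : IsNuclearRepresentation T φ y)
      (s : Finset S) : ∑ i ∈ s, ‖T (e i)‖ ≤ ∑' n, ‖φ n‖ * ‖y n‖ := by
    have := h.norm_sum_inner_le he hf s
    simp only [hfe] at this
    rw [← RCLike.ofReal_sum, RCLike.norm_ofReal] at this
    exact (le_abs_self _).trans this
  have hsum : Summable fun i : S => ‖T (e i)‖ := by
    obtain ⟨φ, y, h⟩ := hT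
    exact summable_of_sum_le (fun _ => norm_nonneg _) (hle h)
  -- A summable family has countable support, and here every term is nonzero.
  have : Countable S := by
    have hc := hsum.countable_support
    rwa [Function.support_eq_univ (fun i => norm_ne_zero_iff.2 i.2),
      Set.countable_univ_iff] at hc
  obtain ⟨ψ, z, hrep, hcost⟩ := exists_isNuclearRepresentation_of_countable (T := T)
    (φ := fun i : S => innerSL 𝕜 (e i)) (y := fun i => T (e i))
    (fun i => by rw [innerSL_apply_norm, he.1 i]) hsum fun x => by
      have hx := (b.hasSum_repr x).mapL T
      refine (hasSum_subtype_iff_of_support_subset (f := fun i => inner 𝕜 (b i) x • T (b i))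
        (s := S) fun i hi h0 => hi ?_).2 ?_
      · simp [h0]
      · simpa [b.repr_apply_apply] using hx
  refine ⟨ψ, z, hrep, le_antisymm (csInf_le ⟨0, ?_⟩ ⟨ψ, z, hrep, rfl⟩)
    (le_csInf ⟨_, ψ, z, hrep, rfl⟩ ?_)⟩
  · rintro _ ⟨φ, y, -, rfl⟩
    exact tsum_nonneg fun n => by positivity
  · rintro _ ⟨φ, y, h, rfl⟩
    rw [hcost]
    -- The finite trace bounds pass to the full sum, so no representation is cheaper.
    exact hsum.tsum_le_of_sum_le (hle h)

end Hilbert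

theorem mainTheorem11 {H : Type*} [NormedAddCommGroup H] [InnerProductSpace ℂ H]
    [CompleteSpace H] (T : H →L[ℂ] H) (hT : IsNuclearOperator T) :
    AttainsNuclearNorm T :=
  hT.attainsNuclearNorm
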